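/- Let $X$ be an elliptic curve over $\mathbb{C}$ and $p\in X$ a point. Let $E$ be a vector bundle of rank $3$ on $X$ with trivial determinant, $\bigwedge^3E\cong\mathcal{O}_X$, endowed with a parabolic structure at $p$, that is, a full flag $$0\subsetneq E_{p,1}\subsetneq E_{p,2}\subsetneq E_{p,3}=E|_p$$ in the fibre at $p$ together with real weights $\boldsymbol{\mu}=(\mu_1,\mu_2,\mu_3)$ satisfying $\mu_3\le\mu_2\le\mu_1$, $\mu_1-\mu_3<1$ and $\mu_1+\mu_2+\mu_3=0$. For a subbundle $F\subset E$ (a locally free subsheaf with locally free quotient) of rank $r'\in\{1,2\}$, let $J_F\subset\{1,2,3\}$ be the set of indices $j$ with $F|_p\cap E_{p,j}\ne F|_p\cap E_{p,j-1}$ (where $E_{p,0}=0$); the weights of the induced parabolic structure on $F$ are the $\mu_j$ with $j\in J_F$, and the parabolic slopes are $$\mu_{\mathrm{par}}(F)=\frac{\deg F+\sum_{j\in J_F}\mu_j}{r'},\qquad \mu_{\mathrm{par}}(E)=\frac{\deg E+\mu_1+\mu_2+\mu_3}{3}.$$ Suppose that $(E,E_\bullet)$ is $\boldsymbol{\mu}$-semistable,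 i.e. $\mu_{\mathrm{par}}(F)\le\mu_{\mathrm{par}}(E)$ for every subbundle $F\subset E$ of rank $1$ or $2$. Then $E$ is semistable as a vector bundle, i.e. $\deg F/\operatorname{rk}F\le\deg E/3$ for every subbundle $F\subset E$ of rank $1$ or $2$. -/

import Mathlib

open CategoryTheory AlgebraicGeometry

noncomputable section

namespace ParabolicElliptic

/-! ### Exterior powers of sheaves of modules -/

section ExteriorPower

universe u v w

variable {C : Type v} [Category.{w} C] {R : Cᵒᵖ ⥤ CommRingCat.{u}}

/-- The alternating map `(m₁, …, mₙ) ↦ m₁|_V ∧ … ∧ mₙ|_V` attached to a restriction map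
`M(U) → M(V)` of a presheaf of modules. -/
def extPowAlt (M : PresheafOfModules.{u} (R ⋙ forget₂ _ RingCat.{u})) (n : ℕ)
    {U V : Cᵒᵖ} (f : U ⟶ V) :
    ModuleCat.AlternatingMap (R := R.obj U) (M.obj U)
      ((ModuleCat.restrictScalars (R.map f).hom).obj
        (ModuleCat.exteriorPower (R := R.obj V) (M.obj V) n)) n where
  toFun m := exteriorPower.ιMulti (R.obj V) (M := M.obj V) n (fun i ↦ M.map f (m i))
  map_update_add' m i x y := by
    have e (z : M.obj U) : (fun j ↦ M.map f (Function.update m i z j)) =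
        Function.update (fun j ↦ (M.map f (m j) : M.obj V)) i (M.map f z) :=
      Function.comp_update (fun z ↦ (M.map f z : M.obj V)) m i z
    have h : (M.map f (x + y) : M.obj V) = (M.map f x : M.obj V) + (M.map f y : M.obj V) :=
      map_add (M.map f).hom x y
    rw [e, e, e, h]
    exact (exteriorPower.ιMulti (R.obj V) (M := M.obj V) n).map_update_add _ i _ _
  map_update_smul' m i c x := by
    have e (z : M.obj U) : (fun j ↦ M.map f (Function.update m i z j)) =
        Function.update (fun j ↦ (M.map f (m j) : M.obj V)) i (M.map f z) :=
      Function.comp_update (fun z ↦ (M.map f z : M.obj V)) m i z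
    have h : (M.map f (c • x) : M.obj V) = R.map f c • (M.map f x : M.obj V) :=
      M.map_smul f c x
    rw [e, e, h]
    exact (exteriorPower.ιMulti (R.obj V) (M := M.obj V) n).map_update_smul _ i _ _
  map_eq_zero_of_eq' m i j h hij :=
    (exteriorPower.ιMulti (R.obj V) (M := M.obj V) n).map_eq_zero_of_eq _
      (congrArg (fun z ↦ (M.map f z : M.obj V)) h) hij

/-- The presheaf `U ↦ ⋀ⁿ_{R(U)} M(U)`. -/
def presheafExteriorPower (M : PresheafOfModules.{u} (R ⋙ forget₂ _ RingCat.{u})) (n : ℕ) :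
    PresheafOfModules.{u} (R ⋙ forget₂ _ RingCat.{u}) where
  obj U := ModuleCat.exteriorPower (R := R.obj U) (M.obj U) n
  map {U V} f := ModuleCat.exteriorPower.desc (R := R.obj U) (extPowAlt M n f)
  map_id U := by
    refine ModuleCat.exteriorPower.hom_ext (R := R.obj U) ?_
    refine ModuleCat.AlternatingMap.ext (R := R.obj U) fun x ↦ ?_
    refine (ModuleCat.exteriorPower.desc_mk (extPowAlt M n (𝟙 U)) x).trans ?_
    have h : (fun i ↦ (M.map (𝟙 U) (x i) : M.obj U)) = x := by
      funext i
      rw [M.map_id]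
      rfl
    exact congrArg (exteriorPower.ιMulti (R.obj U) (M := M.obj U) n) h
  map_comp {U V W} f g := by
    refine ModuleCat.exteriorPower.hom_ext (R := R.obj U) ?_
    refine ModuleCat.AlternatingMap.ext (R := R.obj U) fun x ↦ ?_
    refine (ModuleCat.exteriorPower.desc_mk (extPowAlt M n (f ≫ g)) x).trans ?_
    have h : (fun i ↦ (M.map (f ≫ g) (x i) : M.obj W)) =
        fun i ↦ (M.map g (M.map f (x i) : M.obj V) : M.obj W) :=
      funext fun i ↦ M.map_comp_apply f g (x i)
    refine (congrArg (exteriorPower.ιMulti (R.obj W) (M := M.obj W) n) h).trans ?_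
    refine Eq.symm (Eq.trans (congrArg
      (fun z ↦ ModuleCat.exteriorPower.desc (R := R.obj V) (extPowAlt M n g) z)
      (ModuleCat.exteriorPower.desc_mk (extPowAlt M n f) x)) ?_)
    exact ModuleCat.exteriorPower.desc_mk (extPowAlt M n g)
      (fun i ↦ (M.map f (x i) : M.obj V))

end ExteriorPower

/-- The `n`-th exterior power `⋀ⁿ M` of a sheaf of modules on a scheme: the sheaf associated
with `U ↦ ⋀ⁿ_{𝒪(U)} M(U)`. -/
def exteriorPowerSheaf {X : Scheme.{0}} (n : ℕ) (M : X.Modules) : X.Modules :=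
  (PresheafOfModules.sheafification (𝟙 X.ringCatSheaf.obj)).obj
    (presheafExteriorPower (R := X.presheaf) M.val n)

/-- The structure sheaf as a module over itself. -/
def structureSheaf (X : Scheme.{0}) : X.Modules := SheafOfModules.unit X.ringCatSheaf

/-- A sheaf of modules is locally free of rank `r` (a vector bundle of rank `r`) if every point
has an open neighbourhood `U` with `M|_U ≅ 𝒪_U^r`. -/
def IsLocallyFreeOfRank {X : Scheme.{0}} (M : X.Modules) (r : ℕ) : Prop :=
  ∀ x : X, ∃ U : X.Opens, x ∈ U ∧
    Nonempty (M.restrict U.ι ≅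
      (SheafOfModules.free (R := U.toScheme.ringCatSheaf) (Fin r) : U.toScheme.Modules))

/-! ### Cohomology of sheaves of modules on schemes over `ℂ` -/

/-- The base scheme `Spec ℂ`. -/
abbrev SpecC : Scheme.{0} := Spec (.of ℂ)

/-- The structure map `ℂ → Γ(X, 𝒪_X)` of a scheme over `ℂ`. -/
def scalarMap {X : Scheme.{0}} (π : X ⟶ SpecC) : ℂ →+* Γ(X, ⊤) :=
  ((Scheme.ΓSpecIso (.of ℂ)).inv ≫ π.appTop).hom

/-- A sheaf of modules on `X`, viewed as a sheaf of `Γ(X, 𝒪_X)`-modules. -/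
def toSheafGlobal (X : Scheme.{0}) : X.Modules ⥤ TopCat.Sheaf (ModuleCat.{0} Γ(X, ⊤)) X :=
  SheafOfModules.forgetToSheafModuleCat X.ringCatSheaf (.op ⊤)
    (Limits.initialOpOfTerminal Limits.isTerminalTop)

/-- Restriction of scalars along `ℂ → Γ(X, 𝒪_X)`. -/
def restrictToC {X : Scheme.{0}} (π : X ⟶ SpecC) :
    TopCat.Sheaf (ModuleCat.{0} Γ(X, ⊤)) X ⥤ TopCat.Sheaf (ModuleCat.{0} ℂ) X :=
  sheafCompose _ (ModuleCat.restrictScalars (scalarMap π))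

/-- The sheaf of complex vector spaces underlying a sheaf of modules on a scheme over `ℂ`. -/
def toSheafC {X : Scheme.{0}} (π : X ⟶ SpecC) :
    X.Modules ⥤ TopCat.Sheaf (ModuleCat.{0} ℂ) X :=
  toSheafGlobal X ⋙ restrictToC π

/-- Global sections of sheaves of complex vector spaces. -/
def globalSections (X : Scheme.{0}) : TopCat.Sheaf (ModuleCat.{0} ℂ) X ⥤ ModuleCat.{0} ℂ :=
  TopCat.Sheaf.forget _ _ ⋙ (evaluation _ _).obj (.op ⊤)

instance (X : Scheme.{0}) : (globalSections X).Additive where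
  map_add := rfl

/-- Sheaf cohomology `Hⁱ(X, M)`, as a complex vector space: the right derived functors of
global sections. -/
def cohomology {X : Scheme.{0}} (π : X ⟶ SpecC) (i : ℕ) (M : X.Modules) : ModuleCat.{0} ℂ :=
  ((globalSections X).rightDerived i).obj ((toSheafC π).obj M)

/-- `hⁱ(X, M) = dim_ℂ Hⁱ(X, M)`. -/
def cohomologyDim {X : Scheme.{0}} (π : X ⟶ SpecC) (i : ℕ) (M : X.Modules) : ℕ :=
  Module.finrank ℂ (cohomology π i M)

/-- The Euler characteristic of a coherent sheaf on a curve, `h⁰ - h¹`. -/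
def eulerChar {X : Scheme.{0}} (π : X ⟶ SpecC) (M : X.Modules) : ℤ :=
  (cohomologyDim π 0 M : ℤ) - (cohomologyDim π 1 M : ℤ)

/-- The degree of a vector bundle of rank `r` on a projective curve: the degree of its
determinant line bundle `⋀ʳ M`, where a line bundle `L` has degree `χ(L) - χ(𝒪_X)`. -/
def degree {X : Scheme.{0}} (π : X ⟶ SpecC) (M : X.Modules) (r : ℕ) : ℤ :=
  eulerChar π (exteriorPowerSheaf r M) - eulerChar π (structureSheaf X)

/-- The slope `deg / rank` of a vector bundle of rank `r`. -/
def bundleSlope {X : Scheme.{0}} (π : X ⟶ SpecC) (M : X.Modules) (r : ℕ) : ℝ :=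
  (degree π M r : ℝ) / r

/-! ### Elliptic curves -/

/-- An elliptic curve over `ℂ`: a smooth proper integral curve of genus one with a
distinguished rational point. -/
structure EllipticCurve where
  /-- the underlying scheme -/
  X : Scheme.{0}
  /-- the structure morphism -/
  π : X ⟶ SpecC
  integral : IsIntegral X
  proper : IsProper π
  smooth : SmoothOfRelativeDimension 1 π
  genus_eq_one : cohomologyDim π 1 (structureSheaf X) = 1
  /-- the origin -/
  origin : SpecC ⟶ X
  origin_π : origin ≫ π = 𝟙 SpecC

/-! ### Subbundles and semistability -/

/-- A subbundle of `E`: a locally free subsheaf `F ↪ E` of finite rank with locally free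
quotient `E / F`. -/
structure Subbundle {X : Scheme.{0}} (E : X.Modules) where
  /-- the underlying sheaf -/
  F : X.Modules
  /-- the inclusion -/
  ι : F ⟶ E
  mono : Mono ι
  /-- the rank -/
  rank : ℕ
  locallyFree : IsLocallyFreeOfRank F rank
  quotient_locallyFree : ∃ s : ℕ, IsLocallyFreeOfRank (Limits.cokernel ι) s

/-- A vector bundle `E` of rank `r` is slope-semistable if `μ(F) ≤ μ(E)` for every subbundle
`F` with `0 < rk F < r`. -/
def IsSemistable {X : Scheme.{0}} (π : X ⟶ SpecC) (E : X.Modules) (r : ℕ) : Prop :=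
  ∀ S : Subbundle E, 0 < S.rank → S.rank < r → bundleSlope π S.F S.rank ≤ bundleSlope π E r

/-! ### Parabolic bundles -/

/-- The fibre `E|_p` at a point `p : Spec ℂ ⟶ X`: the complex vector space `Γ(Spec ℂ, p^* E)`. -/
def fibre {X : Scheme.{0}} (p : SpecC ⟶ X) : X.Modules ⥤ ModuleCat.{0} ℂ :=
  Scheme.Modules.pullback p ⋙ moduleSpecΓFunctor (R := .of ℂ)

/-- A parabolic structure at `p` on a vector bundle of rank three. The flag is
`0 = flag 0 ⊊ flag 1 ⊊ flag 2 ⊊ flag 3 = E|_p`, and `weight i` is the weight `μ_{i+1}`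
attached to the step `flag (i + 1)`. -/
structure ParabolicStructure {X : Scheme.{0}} (p : SpecC ⟶ X) (E : X.Modules) where
  /-- the full flag in the fibre -/
  flag : Fin 4 → Submodule ℂ ((fibre p).obj E)
  flag_strictMono : StrictMono flag
  flag_zero : flag 0 = ⊥
  flag_last : flag 3 = ⊤
  /-- the parabolic weights -/
  weight : Fin 3 → ℝ
  weight_antitone : weight 2 ≤ weight 1 ∧ weight 1 ≤ weight 0
  weight_sub_lt : weight 0 - weight 2 < 1
  weight_sum : ∑ i, weight i = 0

namespace ParabolicStructure

variable {X : Scheme.{0}} {p : SpecC ⟶ X} {E : X.Modules}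

/-- The fibre `F|_p` of a subbundle, as a subspace of `E|_p`. -/
def subFibre (p : SpecC ⟶ X) (S : Subbundle E) : Submodule ℂ ((fibre p).obj E) :=
  LinearMap.range ((fibre p).map S.ι).hom

open scoped Classical in
/-- The indices of the weights which are induced on a subbundle: those at which the filtration
`F|_p ∩ flag i` of `F|_p` jumps. A step `V = F|_p ∩ flag i` of the induced flag (with repetitions
removed) thus carries the weight of the smallest member of the flag which contains `V`. -/
def inducedIndices (P : ParabolicStructure p E) (S : Subbundle E) : Finset (Fin 3) :=
  Finset.univ.filter fun i ↦
    subFibre p S ⊓ P.flag i.castSucc ≠ subFibre p S ⊓ P.flag i.succ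

/-- The parabolic slope `(deg E + ∑ μᵢ) / 3` of a parabolic bundle of rank three. -/
def parSlope (π : X ⟶ SpecC) (P : ParabolicStructure p E) : ℝ :=
  ((degree π E 3 : ℝ) + ∑ i, P.weight i) / 3

/-- The parabolic slope of a subbundle with its induced parabolic structure. -/
def parSlopeSub (π : X ⟶ SpecC) (P : ParabolicStructure p E) (S : Subbundle E) : ℝ :=
  ((degree π S.F S.rank : ℝ) + ∑ i ∈ P.inducedIndices S, P.weight i) / S.rank

/-- Parabolic (`μ`-)semistability of a parabolic bundle of rank three: every subbundle `F` with
`0 < rk F < 3`, with its induced parabolic structure, has parabolic slope at most that of `E`. -/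
def IsSemistable (π : X ⟶ SpecC) (P : ParabolicStructure p E) : Prop :=
  ∀ S : Subbundle E, 0 < S.rank → S.rank < 3 → P.parSlopeSub π S ≤ P.parSlope π

end ParabolicStructure

end ParabolicElliptic

end

open ParabolicElliptic

namespace ParabolicElliptic

open CategoryTheory AlgebraicGeometry

/-! Since `degree` is χ(det) − χ(𝒪), a trivial determinant forces deg E = 0; as the weights also sum
to zero, E has parabolic slope 0. Parabolic semistability then says deg F + ∑_{j∈J} μ_j ≤ 0 for a
subbundle F with induced index set J. The weights have sum zero and spread less than 1, so every
partial sum exceeds −1 (`neg_one_lt_sum_weight`). Hence deg F < 1, and integrality gives deg F ≤ 0.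
Because the bound holds for every J, the position of F|_p relative to the flag, and even |J| = rk F,
play no role. -/

/-- Isomorphic sheaves of modules have the same Euler characteristic. -/
theorem eulerChar_congr {X : Scheme.{0}} (π : X ⟶ SpecC) {M N : X.Modules} (e : M ≅ N) :
    eulerChar π M = eulerChar π N := by
  have h (i : ℕ) : cohomologyDim π i M = cohomologyDim π i N :=
    LinearEquiv.finrank_eq
      (((globalSections X).rightDerived i).mapIso ((toSheafC π).mapIso e)).toLinearEquiv
  simp only [eulerChar, h]

/-- A bundle with trivial determinant has degree zero. -/
theorem degree_eq_zero_of_trivial_det {X : Scheme.{0}} (π : X ⟶ SpecC) {M : X.Modules} {r : ℕ}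
    (e : exteriorPowerSheaf r M ≅ structureSheaf X) : degree π M r = 0 :=
  sub_eq_zero.mpr (eulerChar_congr π e)

/-- Any partial sum of the weights of a parabolic structure is greater than `-1`. -/
theorem ParabolicStructure.neg_one_lt_sum_weight {X : Scheme.{0}} {p : SpecC ⟶ X} {E : X.Modules}
    (P : ParabolicStructure p E) (J : Finset (Fin 3)) : -1 < ∑ i ∈ J, P.weight i := by
  obtain ⟨h₂₁, h₁₀⟩ := P.weight_antitone
  have hlt := P.weight_sub_lt
  have hsum := P.weight_sum
  rw [Fin.sum_univ_three] at hsum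
  -- The sum over J becomes three terms, each a weight or 0 according to membership, so that the
  -- eight subsets can be split.
  rw [← Finset.univ_inter J, ← Finset.sum_ite_mem, Fin.sum_univ_three]
  -- Sum zero gives μ₃ ≤ 0 ≤ μ₁, so μ₃ > μ₁ − 1 ≥ −1 settles singletons. A pair sums to minus the
  -- omitted weight, at least −μ₁ > −μ₃ − 1 ≥ −1. The empty and full sums vanish.
  split_ifs <;> linarith

end ParabolicElliptic

theorem mainTheorem11 (C : EllipticCurve) (p : SpecC ⟶ C.X) (hp : p ≫ C.π = 𝟙 SpecC)
    (E : C.X.Modules) (hE : IsLocallyFreeOfRank E 3)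
    (hdet : Nonempty (exteriorPowerSheaf 3 E ≅ structureSheaf C.X))
    (P : ParabolicStructure p E) (hP : P.IsSemistable C.π) :
    IsSemistable C.π E 3 := by
  intro S hpos hlt
  obtain ⟨e⟩ := hdet
  have hdeg : degree C.π E 3 = 0 := degree_eq_zero_of_trivial_det C.π e
  have hrank : (0 : ℝ) < S.rank := Nat.cast_pos.mpr hpos
  have hpar := hP S hpos hlt
  rw [ParabolicStructure.parSlopeSub, ParabolicStructure.parSlope, hdeg, P.weight_sum,
    Int.cast_zero, add_zero, zero_div, div_le_iff₀ hrank, zero_mul] at hpar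
  have hJ := P.neg_one_lt_sum_weight (P.inducedIndices S)
  -- The strict real bound is moved to ℤ, where < 1 means ≤ 0.
  have hS : degree C.π S.F S.rank < 1 := by
    have : (degree C.π S.F S.rank : ℝ) < 1 := by linarith
    exact_mod_cast this
  rw [bundleSlope, bundleSlope, hdeg, Int.cast_zero, zero_div, div_le_iff₀ hrank, zero_mul]
  exact_mod_cast Int.lt_add_one_iff.mp hS
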